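/- All graphs are finite and simple. For a connected graph $G$, a locating $k$-coloring is a proper coloring of $V(G)$ with $k$ nonempty color classes $C_1,\dots,C_k$ such that distinct vertices $v$ have distinct color codes $(d(v,C_1),\dots,d(v,C_k))$, where $d(v,C_i)=\min\{d(v,x)\mid x\in C_i\}$; the locating-chromatic number $\chi_L(G)$ is the least $k$ for which $G$ has a locating $k$-coloring. The corona product $G\odot H$ is obtained from one copy of $G$ and $|V(G)|$ copies of $H$, one for each vertex of $G$, by joining each vertex $u$ of $G$ to every vertex of the copy of $H$ that belongs to $u$. Let $\overline{K_1}$ be the graph with one vertex and no edge, $P_6$ the path with $6$ vertices, and $G_3$ the tree with $6$ vertices obtained from the path with $5$ vertices by attaching one pendant vertex to its middle vertex. Theorem. For $n\ge 2$, let $T_n$ be a tree with $n$ vertices such that $\chi_L(T_n)=3$. Then $$\chi_L(T_n\odot \overline{K_1})=\begin{cases}3, & \text{if } T_n \text{ is isomorphic to a subgraph of } P_6 \text{ or of } G_3,\\ 4, & \text{otherwise.}\end{cases}$$ -/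

import Mathlib

namespace LocatingChromatic

/-- The distance `d(v, S) = min {d(v, x) | x ∈ S}` from a vertex to a (nonempty) vertex set. -/
noncomputable def distToSet {V : Type*} (G : SimpleGraph V) (v : V) (S : Set V) : ℕ :=
  sInf (G.dist v '' S)

/-- The color code of a vertex with respect to a coloring: its distances to all color classes. -/
noncomputable def colorCode {V : Type*} (G : SimpleGraph V) {k : ℕ} (c : G.Coloring (Fin k))
    (v : V) : Fin k → ℕ :=
  fun i => distToSet G v (c.colorClass i)

/-- A locating coloring: a proper coloring with `k` nonempty color classes such that distinct
vertices have distinct color codes. -/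
def IsLocatingColoring {V : Type*} (G : SimpleGraph V) {k : ℕ} (c : G.Coloring (Fin k)) : Prop :=
  Function.Surjective c ∧ Function.Injective (colorCode G c)

/-- The locating-chromatic number `χ_L(G)` of a finite connected graph: the least `k` such that
`G` has a locating coloring with `k` colors. -/
noncomputable def locatingChromaticNumber {V : Type*} (G : SimpleGraph V) : ℕ :=
  sInf {k : ℕ | ∃ c : G.Coloring (Fin k), IsLocatingColoring G c}

/-- The adjacency relation of the corona product: `Sum.inl u` is the vertex `u` of `G`, and
`Sum.inr (u, x)` is the vertex `x` of the copy of `H` attached to `u`. -/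
def coronaAdj {V W : Type*} (G : SimpleGraph V) (H : SimpleGraph W) :
    V ⊕ V × W → V ⊕ V × W → Prop
  | Sum.inl u, Sum.inl v => G.Adj u v
  | Sum.inl u, Sum.inr p => u = p.1
  | Sum.inr p, Sum.inl u => p.1 = u
  | Sum.inr p, Sum.inr q => p.1 = q.1 ∧ H.Adj p.2 q.2

/-- The corona product `G ⊙ H`: one copy of `G` and, for each vertex `u` of `G`, a copy of `H`
all of whose vertices are joined to `u`. -/
def corona {V W : Type*} (G : SimpleGraph V) (H : SimpleGraph W) :
    SimpleGraph (V ⊕ V × W) where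
  Adj := coronaAdj G H
  symm := ⟨by
    rintro (u | p) (v | q) h
    · exact G.adj_symm h
    · exact Eq.symm h
    · exact Eq.symm h
    · exact ⟨h.1.symm, H.adj_symm h.2⟩⟩
  loopless := ⟨by
    rintro (u | p) h
    · exact G.irrefl h
    · exact H.irrefl h.2⟩

/-- The tree `G₃`: the path `0 - 1 - 2 - 3 - 4` with a pendant vertex `5` attached to its middle
vertex `2`. -/
def graphG3 : SimpleGraph (Fin 6) :=
  SimpleGraph.fromEdgeSet {s(0, 1), s(1, 2), s(2, 3), s(3, 4), s(2, 5)}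

end LocatingChromatic

namespace LocatingChromatic

open SimpleGraph

section Distance

variable {V : Type*} {G : SimpleGraph V}

theorem distToSet_le (v : V) {S : Set V} {x : V} (hx : x ∈ S) : distToSet G v S ≤ G.dist v x :=
  Nat.sInf_le ⟨x, hx, rfl⟩

theorem exists_dist_eq_distToSet (v : V) {S : Set V} (hS : S.Nonempty) :
    ∃ x ∈ S, G.dist v x = distToSet G v S :=
  Nat.sInf_mem (hS.image (G.dist v))

theorem distToSet_eq_zero_iff (hG : G.Connected) {v : V} {S : Set V} (hS : S.Nonempty) :
    distToSet G v S = 0 ↔ v ∈ S := by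
  constructor
  · intro h
    obtain ⟨x, hx, hd⟩ := exists_dist_eq_distToSet (G := G) v hS
    rw [h, hG.dist_eq_zero_iff] at hd
    exact hd ▸ hx
  · intro h
    have := distToSet_le (G := G) v h
    simpa using this

theorem distToSet_le_add_one (hG : G.Connected) {u v : V} (h : G.Adj u v) {S : Set V}
    (hS : S.Nonempty) : distToSet G u S ≤ distToSet G v S + 1 := by
  obtain ⟨x, hx, hd⟩ := exists_dist_eq_distToSet (G := G) v hS
  have h1 := distToSet_le (G := G) u hx
  have h2 : G.dist u x ≤ G.dist u v + G.dist v x := hG.dist_triangle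
  rw [dist_eq_one_iff_adj.2 h] at h2
  omega

theorem exists_adj_distToSet_add_one (hG : G.Connected) {v : V} {S : Set V} (hS : S.Nonempty)
    (hv : distToSet G v S ≠ 0) : ∃ w, G.Adj v w ∧ distToSet G w S + 1 = distToSet G v S := by
  obtain ⟨x, hx, hd⟩ := exists_dist_eq_distToSet (G := G) v hS
  obtain ⟨p, hp⟩ := hG.exists_walk_length_eq_dist v x
  cases p with
  | nil => simp only [dist_self] at hd; omega
  | cons h q =>
    rename_i w
    refine ⟨w, h, ?_⟩
    have h1 := distToSet_le (G := G) w hx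
    have h2 := dist_le q
    have h3 := distToSet_le_add_one hG h hS
    simp only [Walk.length_cons] at hp
    omega

/-- A function with the local properties of the distances to the color classes is the color
code. -/
theorem exists_isLocatingColoring_of_code [Nonempty V] (hG : G.Connected) {k : ℕ} (c : V → Fin k)
    (g : V → Fin k → ℕ) (hzero : ∀ v i, g v i = 0 ↔ c v = i)
    (hproper : ∀ u v, G.Adj u v → c u ≠ c v)
    (hlip : ∀ u v, G.Adj u v → ∀ i, g u i ≤ g v i + 1)
    (hdesc : ∀ v i, g v i ≠ 0 → ∃ w, G.Adj v w ∧ g w i + 1 = g v i)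
    (hinj : Function.Injective g) :
    ∃ c : G.Coloring (Fin k), IsLocatingColoring G c := by
  let C : G.Coloring (Fin k) := Coloring.mk c fun {u v} h => hproper u v h
  have hreach : ∀ i n v, g v i = n → ∃ x, c x = i ∧ ∃ p : G.Walk v x, p.length = n := by
    intro i n
    induction n with
    | zero => exact fun v hv => ⟨v, (hzero v i).1 hv, .nil, rfl⟩
    | succ n ih =>
      intro v hv
      obtain ⟨w, hw, hwv⟩ := hdesc v i (by omega)
      obtain ⟨x, hx, p, hp⟩ := ih w (by omega)
      exact ⟨x, hx, .cons hw p, by simp [hp]⟩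
  have hwalk : ∀ i v x (p : G.Walk v x), g v i ≤ g x i + p.length := by
    intro i v x p
    induction p with
    | nil => simp
    | cons h q ih =>
      have := hlip _ _ h i
      simp only [Walk.length_cons]
      omega
  have hcode : colorCode G C = g := by
    funext v i
    obtain ⟨x, hx, p, hp⟩ := hreach i _ v rfl
    have hxC : x ∈ C.colorClass i := hx
    apply le_antisymm
    · exact (distToSet_le v hxC).trans ((dist_le p).trans hp.le)
    · obtain ⟨y, hy, hd⟩ := exists_dist_eq_distToSet (G := G) v ⟨x, hxC⟩
      obtain ⟨q, hq⟩ := hG.exists_walk_length_eq_dist v y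
      have h1 := hwalk i v y q
      have h2 : g y i = 0 := (hzero y i).2 hy
      change g v i ≤ distToSet G v _
      omega
  refine ⟨C, fun i => ?_, hcode ▸ hinj⟩
  obtain ⟨x, hx, -⟩ := hreach i _ (Classical.arbitrary V) rfl
  exact ⟨x, hx⟩

theorem three_le_of_isLocatingColoring [Fintype V] (hG : G.Connected) (hV : 3 ≤ Fintype.card V)
    {k : ℕ} {c : G.Coloring (Fin k)} (hc : IsLocatingColoring G c) : 3 ≤ k := by
  by_contra hk
  have : Nontrivial V := Fintype.one_lt_card_iff_nontrivial.1 (by omega)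
  have key : ∀ v i, colorCode G c v i = if c v = i then 0 else 1 := by
    intro v i
    have hne : (c.colorClass i).Nonempty := hc.1 i
    split_ifs with h
    · exact (distToSet_eq_zero_iff hG hne).2 h
    · have h0 : distToSet G v (c.colorClass i) ≠ 0 := fun h' =>
        h ((distToSet_eq_zero_iff hG hne).1 h')
      obtain ⟨w, hw⟩ := hG.preconnected.exists_adj_of_nontrivial v
      have hwi : c w = i := by
        have := c.valid hw
        by_contra hwi
        have := (c v).2
        have := (c w).2
        have := i.2
        simp only [Fin.ext_iff] at *
        omega
      have h1 := distToSet_le (G := G) v (show w ∈ c.colorClass i from hwi)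
      rw [dist_eq_one_iff_adj.2 hw] at h1
      change distToSet G v (c.colorClass i) = 1
      omega
  have hinj : Function.Injective c := fun u v huv =>
    hc.2 (by funext i; rw [key, key, huv])
  have := Fintype.card_le_of_injective c hinj
  simp at this
  omega

end Distance

section Corona

variable {V : Type*} {T : SimpleGraph V}

/-- The graph obtained by attaching one pendant vertex to every vertex. -/
abbrev pendantCorona (T : SimpleGraph V) : SimpleGraph (V ⊕ V × Fin 1) :=
  corona T (completeGraph (Fin 1))ᶜ

theorem pendantCorona_adj_inl_inl {u v : V} :
    (pendantCorona T).Adj (Sum.inl u) (Sum.inl v) ↔ T.Adj u v := Iff.rfl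

theorem pendantCorona_adj_inl_inr {u : V} {p : V × Fin 1} :
    (pendantCorona T).Adj (Sum.inl u) (Sum.inr p) ↔ u = p.1 := Iff.rfl

theorem not_pendantCorona_adj_inr_inr {p q : V × Fin 1} :
    ¬ (pendantCorona T).Adj (Sum.inr p) (Sum.inr q) := by
  rintro ⟨-, h⟩
  exact h.ne (Subsingleton.elim _ _)

theorem pendantCorona_connected (hT : T.Connected) : (pendantCorona T).Connected := by
  have hcore : ∀ u v, (pendantCorona T).Reachable (Sum.inl u) (Sum.inl v) := fun u v =>
    (hT u v).map ⟨Sum.inl, fun h => h⟩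
  have hpend : ∀ p : V × Fin 1, (pendantCorona T).Reachable (Sum.inl p.1) (Sum.inr p) := fun p =>
    Adj.reachable (pendantCorona_adj_inl_inr.2 rfl)
  have := hT.nonempty
  refine Connected.mk ?_
  rintro (u | p) (v | q)
  · exact hcore u v
  · exact (hcore u q.1).trans (hpend q)
  · exact (hpend p).symm.trans (hcore p.1 v)
  · exact (hpend p).symm.trans ((hcore p.1 q.1).trans (hpend q))

/-- Local data on the vertices and on the pendant vertices that give a locating coloring. -/
theorem exists_isLocatingColoring_pendantCorona (hT : T.Connected) {k : ℕ} (c c' : V → Fin k)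
    (g g' : V → Fin k → ℕ) (hzero : ∀ v i, g v i = 0 ↔ c v = i)
    (hzero' : ∀ v i, g' v i = 0 ↔ c' v = i)
    (hproper : ∀ u v, T.Adj u v → c u ≠ c v) (hproper' : ∀ v, c v ≠ c' v)
    (hlip : ∀ u v, T.Adj u v → ∀ i, g u i ≤ g v i + 1)
    (hlip' : ∀ v i, g v i ≤ g' v i + 1)
    (hdesc : ∀ v i, g v i ≠ 0 → g' v i + 1 = g v i ∨ ∃ w, T.Adj v w ∧ g w i + 1 = g v i)
    (hdesc' : ∀ v i, g' v i ≠ 0 → g v i + 1 = g' v i)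
    (hinj : Function.Injective (Sum.elim g g')) :
    ∃ c : (pendantCorona T).Coloring (Fin k), IsLocatingColoring (pendantCorona T) c := by
  have := hT.nonempty
  refine exists_isLocatingColoring_of_code (pendantCorona_connected hT)
    (Sum.elim c (c' ∘ Prod.fst)) (Sum.elim g (g' ∘ Prod.fst)) ?_ ?_ ?_ ?_ ?_
  · rintro (u | p) i
    · exact hzero u i
    · exact hzero' p.1 i
  · rintro (u | p) (v | q) h
    · exact hproper u v h
    · obtain rfl : u = q.1 := h
      exact hproper' _
    · obtain rfl : p.1 = v := h
      exact (hproper' _).symm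
    · exact (not_pendantCorona_adj_inr_inr h).elim
  · rintro (u | p) (v | q) h i
    · exact hlip u v h i
    · obtain rfl : u = q.1 := h
      exact hlip' _ _
    · obtain rfl : p.1 = v := h
      simp only [Sum.elim_inl, Sum.elim_inr, Function.comp]
      by_cases h0 : g' p.1 i = 0
      · omega
      · exact (hdesc' _ _ h0).ge
    · exact (not_pendantCorona_adj_inr_inr h).elim
  · rintro (u | p) i h
    · rcases hdesc u i h with h1 | ⟨w, hw, h1⟩
      · exact ⟨Sum.inr (u, 0), rfl, h1⟩
      · exact ⟨Sum.inl w, hw, h1⟩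
    · exact ⟨Sum.inl p.1, rfl, hdesc' _ _ h⟩
  · rintro (u | p) (v | q) h
    · exact congrArg Sum.inl (Sum.inl_injective (@hinj (.inl u) (.inl v) h))
    · exact (Sum.inl_ne_inr (@hinj (.inl u) (.inr q.1) h)).elim
    · exact (Sum.inr_ne_inl (@hinj (.inr p.1) (.inl v) h)).elim
    · have := Sum.inr_injective (@hinj (.inr p.1) (.inr q.1) h)
      exact congrArg Sum.inr (Prod.ext this (Subsingleton.elim _ _))

/-- Giving a new color to all pendant vertices extends a locating coloring. -/
theorem exists_isLocatingColoring_pendantCorona_succ (hT : T.Connected) {k : ℕ}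
    {c : T.Coloring (Fin k)} (hc : IsLocatingColoring T c) :
    ∃ c : (pendantCorona T).Coloring (Fin (k + 1)), IsLocatingColoring (pendantCorona T) c := by
  have hne : ∀ i, (c.colorClass i).Nonempty := hc.1
  refine exists_isLocatingColoring_pendantCorona hT (fun v => (c v).castSucc) (fun _ => Fin.last k)
    (fun v => Fin.snoc (α := fun _ => ℕ) (colorCode T c v) 1)
    (fun v => Fin.snoc (α := fun _ => ℕ) (fun i => colorCode T c v i + 1) 0)
    ?_ ?_ ?_ ?_ ?_ ?_ ?_ ?_ ?_
  · intro v i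
    induction i using Fin.lastCases with
    | last => simp
    | cast i =>
      simp only [Fin.snoc_castSucc, Fin.castSucc_inj]
      exact distToSet_eq_zero_iff hT (hne i)
  · intro v i
    induction i using Fin.lastCases with
    | last => simp
    | cast i => simp [(Fin.castSucc_lt_last i).ne']
  · intro u v h
    simpa using c.valid h
  · intro v
    exact (Fin.castSucc_lt_last _).ne
  · intro u v h i
    induction i using Fin.lastCases with
    | last => simp
    | cast i =>
      simp only [Fin.snoc_castSucc]
      exact distToSet_le_add_one hT h (hne i)
  · intro v i
    induction i using Fin.lastCases with
    | last => simp
    | cast i => simp only [Fin.snoc_castSucc]; omega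
  · intro v i
    induction i using Fin.lastCases with
    | last => simp
    | cast i =>
      simp only [Fin.snoc_castSucc]
      exact fun h => Or.inr (exists_adj_distToSet_add_one hT (hne i) h)
  · intro v i
    induction i using Fin.lastCases with
    | last => simp
    | cast i => simp
  · rintro (u | u) (v | v) h
    · refine congrArg Sum.inl (hc.2 (funext fun i => ?_))
      simpa using congrFun h i.castSucc
    · simpa using congrFun h (Fin.last k)
    · simpa using congrFun h (Fin.last k)
    · refine congrArg Sum.inr (hc.2 (funext fun i => ?_))
      simpa using congrFun h i.castSucc

end Corona

section Trees

variable {V : Type*} {T : SimpleGraph V}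

theorem eq_of_adj_of_adj_of_isAcyclic (hT : T.IsAcyclic) {a b c d : V} (hac : a ≠ c)
    (hab : T.Adj a b) (hbc : T.Adj b c) (had : T.Adj a d) (hdc : T.Adj d c) : b = d := by
  have h := (hT.subsingleton_path a c).elim
    ⟨.cons hab (.cons hbc .nil), by simp [hab.ne, hac, hbc.ne]⟩
    ⟨.cons had (.cons hdc .nil), by simp [had.ne, hac, hdc.ne]⟩
  simp at h
  exact h.1

theorem not_adj_of_adj_of_adj_of_isAcyclic (hT : T.IsAcyclic) {a b c : V}
    (hab : T.Adj a b) (hbc : T.Adj b c) : ¬ T.Adj a c := by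
  intro hac
  have h := (hT.subsingleton_path a c).elim
    ⟨.cons hab (.cons hbc .nil), by simp [hab.ne, hac.ne, hbc.ne]⟩
    ⟨.cons hac .nil, by simp [hac.ne]⟩
  simp at h
  exact hbc.ne h.1

theorem not_adj_of_isAcyclic (hT : T.IsAcyclic) {a b v x y : V} (hab : a ≠ b) (hxb : x ≠ b)
    (hay : a ≠ y) (hva : T.Adj v a) (hvb : T.Adj v b) (hax : T.Adj a x) (hby : T.Adj b y) :
    ¬ T.Adj x y := by
  intro hxy
  have h := (hT.subsingleton_path a b).elim
    ⟨.cons hax (.cons hxy (.cons hby.symm .nil)), by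
      simp [hab, hxb, hay, hax.ne, hxy.ne, hby.ne']⟩
    ⟨.cons hva.symm (.cons hvb .nil), by simp [hva.ne', hab, hvb.ne]⟩
  have := congrArg (fun p : T.Path a b => p.1.length) h
  simp at this

theorem exists_adj_dist_add_one (hT : T.Connected) {r v : V} (h : v ≠ r) :
    ∃ w, T.Adj v w ∧ T.dist r w + 1 = T.dist r v := by
  have hd : ∀ x, distToSet T x {r} = T.dist r x := fun x => by simp [distToSet, dist_comm]
  have h0 : distToSet T v {r} ≠ 0 := by
    rw [hd]
    exact fun h' => h (hT.dist_eq_zero_iff.1 h').symm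
  simpa only [hd] using exists_adj_distToSet_add_one hT (Set.singleton_nonempty r) h0

/-- A tree all of whose degrees are at most two is a path. -/
theorem nonempty_iso_pathGraph_of_isTree [Fintype V] [Nontrivial V] (hT : T.IsTree)
    (hdeg : ∀ v x y z, T.Adj v x → T.Adj v y → T.Adj v z → x = y ∨ x = z ∨ y = z) :
    Nonempty (T ≃g pathGraph (Fintype.card V)) := by
  classical
  obtain ⟨r, hr⟩ := hT.exists_vert_degree_one_of_nontrivial
  rw [degree_eq_one_iff_existsUnique_adj] at hr
  have hinj : ∀ n u v, T.dist r u = n → T.dist r v = n → u = v := by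
    intro n
    induction n with
    | zero =>
      intro u v hu hv
      rw [hT.connected.dist_eq_zero_iff] at hu hv
      exact hu.symm.trans hv
    | succ n ih =>
      intro u v hu hv
      obtain ⟨p, hp, hpd⟩ := exists_adj_dist_add_one hT.connected (r := r) (v := u)
        (by rintro rfl; simp at hu)
      obtain ⟨q, hq, hqd⟩ := exists_adj_dist_add_one hT.connected (r := r) (v := v)
        (by rintro rfl; simp at hv)
      obtain rfl := ih p q (by omega) (by omega)
      by_cases hpr : p = r
      · subst hpr
        exact hr.unique hp.symm hq.symm
      · obtain ⟨s, hs, hsd⟩ := exists_adj_dist_add_one hT.connected hpr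
        rcases hdeg p u v s hp.symm hq.symm hs with h | rfl | rfl
        · exact h
        · omega
        · omega
  have hlt : ∀ v, T.dist r v < Fintype.card V := by
    intro v
    obtain ⟨p, hp, hpd⟩ := hT.connected.exists_path_of_dist r v
    exact hpd ▸ hp.length_lt
  let f : V → Fin (Fintype.card V) := fun v => ⟨T.dist r v, hlt v⟩
  have hf : Function.Injective f := fun u v h => hinj _ u v (congrArg Fin.val h) rfl
  have hbij : Function.Bijective f := (Fintype.bijective_iff_injective_and_card f).2 ⟨hf, by simp⟩
  have hback : ∀ u v, T.dist r u + 1 = T.dist r v → T.Adj u v := by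
    intro u v h
    obtain ⟨w, hw, hwd⟩ := exists_adj_dist_add_one hT.connected (r := r) (v := v)
      (by rintro rfl; simp at h)
    obtain rfl := hinj _ u w rfl (by omega)
    exact hw.symm
  refine ⟨⟨Equiv.ofBijective f hbij, fun {u v} => ?_⟩⟩
  rw [pathGraph_adj]
  constructor
  · rintro (h | h)
    · exact hback u v h
    · exact (hback v u h).symm
  · intro h
    have := hT.dist_eq_dist_add_one_of_adj r h
    change T.dist r u + 1 = T.dist r v ∨ T.dist r v + 1 = T.dist r u
    omega

theorem pathGraph_isContained_pathGraph {m n : ℕ} (h : m ≤ n) :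
    (pathGraph m).IsContained (pathGraph n) :=
  ⟨⟨⟨Fin.castLE h, fun {u v} huv => by simpa [pathGraph_adj] using huv⟩, Fin.castLE_injective h⟩⟩

instance decidableAdjGraphG3 : DecidableRel graphG3.Adj := fun a b =>
  decidable_of_iff ((s(a, b) = s(0, 1) ∨ s(a, b) = s(1, 2) ∨ s(a, b) = s(2, 3) ∨ s(a, b) = s(3, 4) ∨
    s(a, b) = s(2, 5)) ∧ a ≠ b) (by simp [graphG3])

/-- A tree of radius two around a vertex with neighbors `a`, `b`, `e`, where `a` and `b` have at
most one further neighbor and `e` has none, is contained in `G₃`. -/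
theorem isContained_graphG3_of_isAcyclic (hT : T.IsAcyclic) {v a b e : V} (hab : a ≠ b)
    (hae : a ≠ e) (hbe : b ≠ e) (ha : T.Adj v a) (hb : T.Adj v b) (he : T.Adj v e)
    (hN : ∀ x, T.Adj v x → x = a ∨ x = b ∨ x = e)
    (hrad : ∀ x, x = v ∨ T.Adj v x ∨ ∃ w, T.Adj v w ∧ T.Adj w x)
    (ha2 : ∀ x y, T.Adj a x → T.Adj a y → x ≠ v → y ≠ v → x = y)
    (hb2 : ∀ x y, T.Adj b x → T.Adj b y → x ≠ v → y ≠ v → x = y)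
    (he2 : ∀ x, T.Adj e x → x = v) : T.IsContained graphG3 := by
  classical
  have hcase : ∀ x, x = v ∨ x = a ∨ x = b ∨ x = e ∨
      (x ≠ v ∧ x ≠ a ∧ x ≠ b ∧ x ≠ e ∧ T.Adj a x) ∨
      (x ≠ v ∧ x ≠ a ∧ x ≠ b ∧ x ≠ e ∧ ¬ T.Adj a x ∧ T.Adj b x) := by
    intro x
    rcases hrad x with h | h | ⟨w, hw, hwx⟩
    · exact Or.inl h
    · rcases hN x h with h | h | h <;> simp [h]
    · rcases hN w hw with rfl | rfl | rfl
      · tauto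
      · tauto
      · exact Or.inl (he2 x hwx)
  let f : V → Fin 6 := fun x => if x = v then 2 else if x = a then 1 else if x = b then 3 else
    if x = e then 5 else if T.Adj a x then 0 else 4
  have fv : f v = 2 := by simp [f]
  have fa : f a = 1 := by simp [f, ha.ne']
  have fb : f b = 3 := by simp [f, hb.ne', hab.symm]
  have fe : f e = 5 := by simp [f, he.ne', hae.symm, hbe.symm]
  have f0 : ∀ x, x ≠ v → x ≠ a → x ≠ b → x ≠ e → T.Adj a x → f x = 0 := fun x h1 h2 h3 h4 h5 => by
    simp [f, h1, h2, h3, h4, h5]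
  have f4 : ∀ x, x ≠ v → x ≠ a → x ≠ b → x ≠ e → ¬ T.Adj a x → f x = 4 :=
    fun x h1 h2 h3 h4 h5 => by simp [f, h1, h2, h3, h4, h5]
  have hadj : ∀ x y, T.Adj x y → graphG3.Adj (f x) (f y) := by
    have hv : ∀ y, T.Adj v y → graphG3.Adj (f v) (f y) := by
      intro y h
      rcases hN y h with rfl | rfl | rfl
      · rw [fv, fa]; decide
      · rw [fv, fb]; decide
      · rw [fv, fe]; decide
    have htri : ∀ x y, T.Adj v x → T.Adj v y → ¬ T.Adj x y := fun x y hx hy =>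
      not_adj_of_adj_of_adj_of_isAcyclic hT hx.symm hy
    have ha' : ∀ y, T.Adj a y → graphG3.Adj (f a) (f y) := by
      intro y h
      rcases hcase y with rfl | rfl | rfl | rfl | ⟨y1, y2, y3, y4, y5⟩ | ⟨y1, y2, y3, y4, y5, y6⟩
      · exact (hv a h.symm).symm
      · exact (h.ne rfl).elim
      · exact (htri _ _ ha hb h).elim
      · exact (htri _ _ ha he h).elim
      · rw [fa, f0 y y1 y2 y3 y4 y5]; decide
      · exact (y5 h).elim
    have hb' : ∀ y, T.Adj b y → graphG3.Adj (f b) (f y) := by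
      intro y h
      rcases hcase y with rfl | rfl | rfl | rfl | ⟨y1, y2, y3, y4, y5⟩ | ⟨y1, y2, y3, y4, y5, y6⟩
      · exact (hv b h.symm).symm
      · exact (htri _ _ hb ha h).elim
      · exact (h.ne rfl).elim
      · exact (htri _ _ hb he h).elim
      · exact (y1 (eq_of_adj_of_adj_of_isAcyclic hT hab y5 h.symm ha.symm hb)).elim
      · rw [fb, f4 y y1 y2 y3 y4 y5]; decide
    have he' : ∀ y, T.Adj e y → graphG3.Adj (f e) (f y) := by
      intro y h
      obtain rfl := he2 y h
      exact (hv e h.symm).symm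
    intro x y h
    rcases hcase x with rfl | rfl | rfl | rfl | ⟨x1, x2, x3, x4, x5⟩ | ⟨x1, x2, x3, x4, x5, x6⟩
    · exact hv y h
    · exact ha' y h
    · exact hb' y h
    · exact he' y h
    all_goals
      rcases hcase y with rfl | rfl | rfl | rfl | ⟨y1, y2, y3, y4, y5⟩ | ⟨y1, y2, y3, y4, y5, y6⟩
      · exact (hv x h.symm).symm
      · exact (ha' x h.symm).symm
      · exact (hb' x h.symm).symm
      · exact (he' x h.symm).symm
    · exact (not_adj_of_adj_of_adj_of_isAcyclic hT x5.symm y5 h).elim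
    · exact (not_adj_of_isAcyclic hT hab x3 y2.symm ha hb x5 y6 h).elim
    · exact (not_adj_of_isAcyclic hT hab y3 x2.symm ha hb y5 x6 h.symm).elim
    · exact (not_adj_of_adj_of_adj_of_isAcyclic hT x6.symm y6 h).elim
  have hinj : Function.Injective f := by
    intro x y hxy
    rcases hcase x with rfl | rfl | rfl | rfl | ⟨x1, x2, x3, x4, x5⟩ | ⟨x1, x2, x3, x4, x5, x6⟩ <;>
    rcases hcase y with rfl | rfl | rfl | rfl | ⟨y1, y2, y3, y4, y5⟩ | ⟨y1, y2, y3, y4, y5, y6⟩ <;>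
    first
    | rfl
    | exact ha2 x y x5 y5 x1 y1
    | exact hb2 x y x6 y6 x1 y1
    | (simp [*] at hxy)
  exact ⟨⟨⟨f, fun {x y} h => hadj x y h⟩, hinj⟩⟩

end Trees

section LowerBound

variable {V : Type*} {T : SimpleGraph V}

/-- Three-color locating colorings of `T ⊙ K₁`, described on `T`: the color `c v` of a vertex, the
color `c' v` of its pendant vertex, and the distance `t v` of `v` to the third color. -/
structure PendantLocatingData (T : SimpleGraph V) where
  /-- The color of a vertex. -/
  c : V → Fin 3
  /-- The color of the pendant vertex of a vertex. -/
  c' : V → Fin 3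
  /-- The distance of a vertex to the color that is neither its own nor that of its pendant. -/
  t : V → ℕ
  c_ne_c' : ∀ u, c u ≠ c' u
  c_ne_of_adj : ∀ u w, T.Adj u w → c u ≠ c w
  one_le_t : ∀ u, 1 ≤ t u
  eq_of_t_eq_one : ∀ u w, t u = 1 → t w = 1 → c u = c w → u = w
  eq_of_code_eq : ∀ u w, t u = t w → c u = c w → c' u = c' w → u = w
  t_ne_succ : ∀ u w, c u = c' w → c' u = c w → t u ≠ t w + 1
  c_eq_of_adj : ∀ u w, 2 ≤ t u → T.Adj u w → c w = c' u
  t_le_of_adj : ∀ u w, 2 ≤ t u → 2 ≤ t w → T.Adj u w → t u ≤ t w + 1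
  exists_adj_of_two_le : ∀ u, 2 ≤ t u →
    ∃ w, T.Adj u w ∧ (2 ≤ t w → t w + 1 = t u) ∧ (t w = 1 → t u = 2)

theorem third_color (i j k : Fin 3) (hij : i ≠ j) (hi : k ≠ i) (hj : k ≠ j) : k = -(i + j) := by
  revert i j k; decide

theorem third_color_ne (i j : Fin 3) (hij : i ≠ j) : -(i + j) ≠ i ∧ -(i + j) ≠ j := by
  revert i j; decide

theorem nonempty_pendantLocatingData (hT : T.Connected) {C : (pendantCorona T).Coloring (Fin 3)}
    (hC : IsLocatingColoring (pendantCorona T) C) : Nonempty (PendantLocatingData T) := by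
  have hS := pendantCorona_connected hT
  have hne : ∀ i, (C.colorClass i).Nonempty := hC.1
  let c : V → Fin 3 := fun u => C (Sum.inl u)
  let c' : V → Fin 3 := fun u => C (Sum.inr (u, 0))
  let A : V → Fin 3 → ℕ := fun u => colorCode (pendantCorona T) C (Sum.inl u)
  let B : V → Fin 3 → ℕ := fun u => colorCode (pendantCorona T) C (Sum.inr (u, 0))
  have hcc' : ∀ u, c u ≠ c' u := fun u => C.valid (pendantCorona_adj_inl_inr.2 rfl)
  have hA0 : ∀ u i, A u i = 0 ↔ c u = i := fun u i => distToSet_eq_zero_iff hS (hne i)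
  have hB0 : ∀ u i, B u i = 0 ↔ c' u = i := fun u i => distToSet_eq_zero_iff hS (hne i)
  have hAlip : ∀ u w, T.Adj u w → ∀ i, A u i ≤ A w i + 1 := fun u w h i =>
    distToSet_le_add_one hS (pendantCorona_adj_inl_inl.2 h) (hne i)
  have hABlip : ∀ u i, A u i ≤ B u i + 1 := fun u i =>
    distToSet_le_add_one hS (pendantCorona_adj_inl_inr (p := (u, 0)).2 rfl) (hne i)
  have hB : ∀ u i, c' u ≠ i → B u i = A u i + 1 := by
    intro u i h
    obtain ⟨w, hw, hd⟩ := exists_adj_distToSet_add_one hS (v := Sum.inr (u, 0)) (hne i)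
      (fun h' => h ((hB0 u i).1 h'))
    rcases w with w | q
    · obtain rfl : u = w := hw
      exact hd.symm
    · exact (not_pendantCorona_adj_inr_inr hw).elim
  have hA1 : ∀ u, A u (c' u) = 1 := by
    intro u
    have h1 := hABlip u (c' u)
    rw [(hB0 u (c' u)).2 rfl] at h1
    have h2 : A u (c' u) ≠ 0 := fun h => hcc' u ((hA0 _ _).1 h)
    omega
  have hAdesc : ∀ u i, c u ≠ i → c' u ≠ i → ∃ w, T.Adj u w ∧ A w i + 1 = A u i := by
    intro u i h h'
    obtain ⟨w, hw, hd⟩ := exists_adj_distToSet_add_one hS (v := Sum.inl u) (hne i)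
      (fun h'' => h ((hA0 u i).1 h''))
    rcases w with w | ⟨q, z⟩
    · exact ⟨w, hw, hd⟩
    · obtain rfl : u = q := hw
      obtain rfl : z = 0 := Subsingleton.elim _ _
      change B u i + 1 = A u i at hd
      have := hB u i h'
      omega
  let t : V → ℕ := fun u => A u (-(c u + c' u))
  have ht : ∀ u i, i ≠ c u → i ≠ c' u → A u i = t u := fun u i h h' => by
    rw [third_color _ _ i (hcc' u) h h']
  have hk : ∀ u, -(c u + c' u) ≠ c u ∧ -(c u + c' u) ≠ c' u := fun u => third_color_ne _ _ (hcc' u)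
  have hAc : ∀ u i, c u = i → A u i = 0 := fun u i => (hA0 u i).2
  have hAc' : ∀ u i, c' u = i → A u i = 1 := fun u i h => h ▸ hA1 u
  have hAinj : ∀ u w, A u = A w → u = w := fun u w h => Sum.inl_injective (hC.2 h)
  have hcadj : ∀ u w, 2 ≤ t u → T.Adj u w → c w = c' u := by
    intro u w h hw
    by_contra hne'
    have h1 : c w ≠ c u := (C.valid (pendantCorona_adj_inl_inl.2 hw)).symm
    have h2 := ht u (c w) h1 hne'
    have h3 := hAlip u w hw (c w)
    rw [hAc w _ rfl] at h3
    omega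
  have hc'adj : ∀ u w, 2 ≤ t u → 2 ≤ t w → T.Adj u w → A w (-(c u + c' u)) = t w := by
    intro u w hu hw h
    have h1 := hcadj u w hu h
    have h2 := hcadj w u hw h.symm
    exact ht w _ (h1 ▸ (hk u).2) (h2 ▸ (hk u).1)
  refine ⟨⟨c, c', t, hcc', fun u w h => C.valid (pendantCorona_adj_inl_inl.2 h), ?_, ?_, ?_, ?_,
    hcadj, ?_, ?_⟩⟩
  · intro u
    exact Nat.one_le_iff_ne_zero.2 fun h => (hk u).1 ((hA0 _ _).1 h).symm
  · intro u w hu hw huw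
    refine hAinj u w (funext fun i => ?_)
    have h1 : ∀ u, t u = 1 → c u ≠ i → A u i = 1 := by
      intro u hu h
      by_cases h' : c' u = i
      · exact hAc' u i h'
      · rw [ht u i (Ne.symm h) (Ne.symm h'), hu]
    by_cases h : c u = i
    · rw [hAc u i h, hAc w i (huw ▸ h)]
    · rw [h1 u hu h, h1 w hw (huw ▸ h)]
  · intro u w htt hcw hcw'
    refine hAinj u w (funext fun i => ?_)
    by_cases h : c u = i
    · rw [hAc u i h, hAc w i (hcw ▸ h)]
    · by_cases h' : c' u = i
      · rw [hAc' u i h', hAc' w i (hcw' ▸ h')]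
      · rw [ht u i (Ne.symm h) (Ne.symm h'), ht w i (hcw ▸ Ne.symm h) (hcw' ▸ Ne.symm h'), htt]
  · intro u w hcw hcw' htt
    have hAB : A u = B w := by
      funext i
      by_cases h : c u = i
      · rw [hAc u i h, (hB0 w i).2 (hcw ▸ h)]
      · rw [hB w i (hcw ▸ h)]
        by_cases h' : c' u = i
        · rw [hAc' u i h', hAc w i (hcw' ▸ h')]
        · rw [ht u i (Ne.symm h) (Ne.symm h'), ht w i (hcw' ▸ Ne.symm h') (hcw ▸ Ne.symm h), htt]
    exact Sum.inl_ne_inr (hC.2 hAB)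
  · intro u w hu hw h
    rw [← hc'adj u w hu hw h]
    exact hAlip u w h _
  · intro u hu
    obtain ⟨w, hw, hd⟩ := hAdesc u _ (hk u).1.symm (hk u).2.symm
    refine ⟨w, hw, fun h => ?_, fun h => ?_⟩
    · rw [← hc'adj u w hu h hw]
      exact hd
    · have h1 : A w (-(c u + c' u)) ≤ 1 := by
        by_cases h1 : c w = -(c u + c' u)
        · rw [hAc w _ h1]; omega
        by_cases h2 : c' w = -(c u + c' u)
        · rw [hAc' w _ h2]
        · rw [ht w _ (Ne.symm h1) (Ne.symm h2), h]
      change A w (-(c u + c' u)) + 1 = t u at hd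
      omega

namespace PendantLocatingData

theorem c'_eq_of_adj (D : PendantLocatingData T)
    {v w : V} (h : T.Adj v w) (hw : D.t w = 2) : D.c' w = D.c v :=
  (D.c_eq_of_adj w v hw.ge h.symm).symm

theorem exists_adj_t_eq_one (D : PendantLocatingData T) {u : V} (hu : 2 ≤ D.t u) :
    D.t u = 2 ∧ ∃ w, T.Adj u w ∧ D.t w = 1 := by
  obtain ⟨w, hw, h2, h1⟩ := D.exists_adj_of_two_le u hu
  rcases (D.one_le_t w).eq_or_lt with h | h
  · exact ⟨h1 h.symm, w, hw, h.symm⟩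
  · exact (D.t_ne_succ u w (D.c_eq_of_adj w u h hw.symm) (D.c_eq_of_adj u w hu hw).symm
      (h2 h).symm).elim

theorem t_eq_one_or_two (D : PendantLocatingData T) (u : V) : D.t u = 1 ∨ D.t u = 2 := by
  rcases (D.one_le_t u).eq_or_lt with h | h
  · exact Or.inl h.symm
  · exact Or.inr (D.exists_adj_t_eq_one h).1

theorem card_le_six [Fintype V] (D : PendantLocatingData T) : Fintype.card V ≤ 6 := by
  let f : V → {p : Fin 3 × Fin 3 // p.1 ≠ p.2} := fun u =>
    if D.t u = 2 then ⟨(D.c u, D.c' u), D.c_ne_c' u⟩ else ⟨(D.c' u, D.c u), (D.c_ne_c' u).symm⟩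
  have hmix : ∀ u w, D.t u = 2 → D.t w = 1 → f u ≠ f w := by
    intro u w hu hw h
    simp [f, hu, hw] at h
    exact D.t_ne_succ u w h.1 h.2 (by omega)
  have hf : Function.Injective f := by
    intro u w h
    rcases D.t_eq_one_or_two u with hu | hu <;> rcases D.t_eq_one_or_two w with hw | hw
    · simp [f, hu, hw] at h
      exact D.eq_of_t_eq_one u w hu hw h.2
    · exact (hmix w u hw hu h.symm).elim
    · exact (hmix u w hu hw h).elim
    · simp [f, hu, hw] at h
      exact D.eq_of_code_eq u w (hu.trans hw.symm) h.1 h.2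
  calc Fintype.card V ≤ Fintype.card {p : Fin 3 × Fin 3 // p.1 ≠ p.2} :=
        Fintype.card_le_of_injective f hf
    _ = 6 := by decide

theorem eq_of_adj (D : PendantLocatingData T)
    {v x y : V} (hx : T.Adj v x) (hy : T.Adj v y) (hc : D.c x = D.c y)
    (ht : D.t x = D.t y) : x = y := by
  rcases D.t_eq_one_or_two x with h | h
  · exact D.eq_of_t_eq_one x y h (ht ▸ h) hc
  · exact D.eq_of_code_eq x y ht hc
      ((D.c'_eq_of_adj hx h).trans (D.c'_eq_of_adj hy (ht ▸ h)).symm)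

theorem c_ne_c'_of_adj (D : PendantLocatingData T)
    {v x : V} (hv : D.t v = 1) (hx : T.Adj v x) (ht : D.t x = 2) :
    D.c x ≠ D.c' v := fun h =>
  D.t_ne_succ x v h (D.c'_eq_of_adj hx ht) (by omega)

/-- The third color of a vertex. -/
def third (D : PendantLocatingData T) (v : V) : Fin 3 := -(D.c v + D.c' v)

/-- The neighbors of a vertex of degree at least three: two of them have both other colors in
their neighborhood, and there is exactly one further neighbor. -/
theorem neighbors_of_three (D : PendantLocatingData T)
    {v x y z : V} (hx : T.Adj v x) (hy : T.Adj v y) (hz : T.Adj v z)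
    (hxy : x ≠ y) (hxz : x ≠ z) (hyz : y ≠ z) :
    D.t v = 1 ∧ (∀ w, T.Adj v w → w = x ∨ w = y ∨ w = z) ∧
      ∃ a b, T.Adj v a ∧ T.Adj v b ∧ a ≠ b ∧ D.t a = 1 ∧ D.t b = 1 := by
  have key : ∀ {p q}, T.Adj v p → T.Adj v q → p ≠ q → ¬ (D.c p = D.c q ∧ D.t p = D.t q) :=
    fun hp hq h h' => h (D.eq_of_adj hp hq h'.1 h'.2)
  have hv : D.t v = 1 := by
    by_contra hv
    have hv2 : 2 ≤ D.t v := by have := D.one_le_t v; omega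
    have h1 := key hx hy hxy
    have h2 := key hx hz hxz
    have h3 := key hy hz hyz
    rw [D.c_eq_of_adj v x hv2 hx, D.c_eq_of_adj v y hv2 hy] at h1
    rw [D.c_eq_of_adj v x hv2 hx, D.c_eq_of_adj v z hv2 hz] at h2
    rw [D.c_eq_of_adj v y hv2 hy, D.c_eq_of_adj v z hv2 hz] at h3
    have := D.t_eq_one_or_two x
    have := D.t_eq_one_or_two y
    have := D.t_eq_one_or_two z
    omega
  have hcase : ∀ w, T.Adj v w → (D.t w = 1 ∧ D.c w = D.c' v) ∨ (D.t w = 1 ∧ D.c w = D.third v) ∨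
      (D.t w = 2 ∧ D.c w = D.third v) := by
    intro w hw
    have h1 : D.c w ≠ D.c v := (D.c_ne_of_adj v w hw).symm
    by_cases h2 : D.c w = D.c' v
    · rcases D.t_eq_one_or_two w with h | h
      · exact Or.inl ⟨h, h2⟩
      · exact (D.c_ne_c'_of_adj hv hw h h2).elim
    · have h3 : D.c w = D.third v := third_color _ _ _ (D.c_ne_c' v) h1 h2
      rcases D.t_eq_one_or_two w with h | h
      · exact Or.inr (Or.inl ⟨h, h3⟩)
      · exact Or.inr (Or.inr ⟨h, h3⟩)
  refine ⟨hv, fun w hw => ?_, ?_⟩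
  · by_contra! hw'
    have h1 := key hx hy hxy
    have h2 := key hx hz hxz
    have h3 := key hy hz hyz
    have h4 := key hw hx hw'.1
    have h5 := key hw hy hw'.2.1
    have h6 := key hw hz hw'.2.2
    have c1 := hcase x hx
    have c2 := hcase y hy
    have c3 := hcase z hz
    have c4 := hcase w hw
    grind
  · have h1 := key hx hy hxy
    have h2 := key hx hz hxz
    have h3 := key hy hz hyz
    have c1 := hcase x hx
    have c2 := hcase y hy
    have c3 := hcase z hz
    have : (D.t x = 1 ∧ D.t y = 1) ∨ (D.t x = 1 ∧ D.t z = 1) ∨ (D.t y = 1 ∧ D.t z = 1) := by grind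
    rcases this with h | h | h
    · exact ⟨x, y, hx, hy, hxy, h⟩
    · exact ⟨x, z, hx, hz, hxz, h⟩
    · exact ⟨y, z, hy, hz, hyz, h⟩

theorem eq_or_adj_of_t_eq_one (D : PendantLocatingData T)
    {v a b : V} (hv : D.t v = 1) (ha : T.Adj v a) (hb : T.Adj v b)
    (hab : a ≠ b) (hta : D.t a = 1) (htb : D.t b = 1) {w : V} (hw : D.t w = 1) :
    w = v ∨ T.Adj v w := by
  have h1 : D.c v ≠ D.c a := D.c_ne_of_adj _ _ ha
  have h2 : D.c v ≠ D.c b := D.c_ne_of_adj _ _ hb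
  have h3 : D.c a ≠ D.c b := fun h => hab (D.eq_of_t_eq_one a b hta htb h)
  have : ∀ i j k l : Fin 3, i ≠ j → i ≠ k → j ≠ k → l = i ∨ l = j ∨ l = k := by decide
  rcases this _ _ _ (D.c w) h1 h2 h3 with h | h | h
  · exact Or.inl (D.eq_of_t_eq_one w v hw hv h)
  · exact Or.inr (D.eq_of_t_eq_one w a hw hta h ▸ ha)
  · exact Or.inr (D.eq_of_t_eq_one w b hw htb h ▸ hb)

theorem eq_of_adj_neighbor (D : PendantLocatingData T)
    (hT : T.IsAcyclic) {v x y z p q r : V} (hx : T.Adj v x) (hy : T.Adj v y)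
    (hz : T.Adj v z) (hxy : x ≠ y) (hxz : x ≠ z) (hyz : y ≠ z) (hp : T.Adj v p) (hq : T.Adj p q)
    (hr : T.Adj p r) (hqv : q ≠ v) (hrv : r ≠ v) : q = r := by
  by_contra hqr
  obtain ⟨-, -, a, b, ha, hb, hab, hta, htb⟩ := D.neighbors_of_three hx hy hz hxy hxz hyz
  obtain ⟨htp, -, a', b', ha', hb', hab', hta', htb'⟩ :=
    D.neighbors_of_three hp.symm hq hr hqv.symm hrv.symm hqr
  have key : ∀ d, T.Adj v d → D.t d = 1 → d = p := fun d hd htd =>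
    (D.eq_or_adj_of_t_eq_one htp ha' hb' hab' hta' htb' htd).resolve_right fun h =>
      not_adj_of_adj_of_adj_of_isAcyclic hT hp h hd
  exact hab ((key a ha hta).trans (key b hb htb).symm)

theorem isContained_graphG3 [Fintype V] (D : PendantLocatingData T)
    (hT : T.IsAcyclic) {v x y z : V} (hx : T.Adj v x)
    (hy : T.Adj v y) (hz : T.Adj v z) (hxy : x ≠ y) (hxz : x ≠ z) (hyz : y ≠ z) :
    T.IsContained graphG3 := by
  classical
  obtain ⟨htv, hN, a, b, ha, hb, hab, hta, htb⟩ := D.neighbors_of_three hx hy hz hxy hxz hyz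
  have hdom : ∀ w, D.t w = 1 → w = v ∨ T.Adj v w := fun w hw =>
    D.eq_or_adj_of_t_eq_one htv ha hb hab hta htb hw
  have hrad : ∀ u, u = v ∨ T.Adj v u ∨ ∃ w, T.Adj v w ∧ T.Adj w u := by
    intro u
    rcases D.t_eq_one_or_two u with h | h
    · exact (hdom u h).imp_right Or.inl
    · obtain ⟨-, w, hw, htw⟩ := D.exists_adj_t_eq_one h.ge
      rcases hdom w htw with rfl | h'
      · exact Or.inr (Or.inl hw.symm)
      · exact Or.inr (Or.inr ⟨w, h', hw.symm⟩)
  have hchild : ∀ p, T.Adj v p → ∀ q r, T.Adj p q → T.Adj p r → q ≠ v → r ≠ v → q = r :=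
    fun p hp q r hq hr hqv hrv => D.eq_of_adj_neighbor hT hx hy hz hxy hxz hyz hp hq hr hqv hrv
  have hleaf : (∀ q, T.Adj x q → q = v) ∨ (∀ q, T.Adj y q → q = v) ∨ (∀ q, T.Adj z q → q = v) := by
    by_contra! h
    obtain ⟨⟨p, hp, hpv⟩, ⟨q, hq, hqv⟩, r, hr, hrv⟩ := h
    have htri : ∀ {d e f}, T.Adj v d → T.Adj v e → T.Adj d f → f ≠ e := by
      rintro d e f hd he hf rfl
      exact not_adj_of_adj_of_adj_of_isAcyclic hT hd hf he
    have hquad : ∀ {d e f g}, T.Adj v d → T.Adj v e → d ≠ e → T.Adj d f → T.Adj e g → f ≠ v →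
        f ≠ g := by
      rintro d e f g hd he hde hf hg hfv rfl
      exact hfv (eq_of_adj_of_adj_of_isAcyclic hT hde hf hg.symm hd.symm he)
    have hnd : [v, x, y, z, p, q, r].Nodup := by
      simp only [List.nodup_cons, List.mem_cons, List.not_mem_nil, or_false, not_or]
      exact ⟨⟨hx.ne, hy.ne, hz.ne, hpv.symm, hqv.symm, hrv.symm⟩,
        ⟨hxy, hxz, (htri hx hx hp).symm, (htri hy hx hq).symm, (htri hz hx hr).symm⟩,
        ⟨hyz, (htri hx hy hp).symm, (htri hy hy hq).symm, (htri hz hy hr).symm⟩,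
        ⟨(htri hx hz hp).symm, (htri hy hz hq).symm, (htri hz hz hr).symm⟩,
        ⟨hquad hx hy hxy hp hq hpv, hquad hx hz hxz hp hr hpv⟩, hquad hy hz hyz hq hr hqv,
        not_false, List.nodup_nil⟩
    have h1 := hnd.length_le_card
    have h2 := D.card_le_six
    simp at h1
    omega
  rcases hleaf with h | h | h
  · exact isContained_graphG3_of_isAcyclic hT hyz hxy.symm hxz.symm hy hz hx
      (fun w hw => by have := hN w hw; tauto) hrad (hchild y hy) (hchild z hz) h
  · exact isContained_graphG3_of_isAcyclic hT hxz hxy hyz.symm hx hz hy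
      (fun w hw => by have := hN w hw; tauto) hrad (hchild x hx) (hchild z hz) h
  · exact isContained_graphG3_of_isAcyclic hT hxy hxz hyz hx hy hz hN hrad (hchild x hx)
      (hchild y hy) h

theorem isContained [Fintype V] [Nontrivial V] (D : PendantLocatingData T) (hT : T.IsTree) :
    T.IsContained (pathGraph 6) ∨ T.IsContained graphG3 := by
  by_cases h : ∀ v x y z, T.Adj v x → T.Adj v y → T.Adj v z → x = y ∨ x = z ∨ y = z
  · obtain ⟨e⟩ := nonempty_iso_pathGraph_of_isTree hT h
    exact Or.inl (IsContained.trans ⟨e.toCopy⟩ (pathGraph_isContained_pathGraph D.card_le_six))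
  · push Not at h
    obtain ⟨v, x, y, z, hx, hy, hz, hxy, hxz, hyz⟩ := h
    exact Or.inr (D.isContained_graphG3 hT.isAcyclic hx hy hz hxy hxz hyz)

end PendantLocatingData

end LowerBound

section UpperBound

variable {V : Type*} {T : SimpleGraph V}

/-- Code tables on a graph `H` restrict to an induced subgraph that contains all vertices of `B`,
when distances to color classes are realized through vertices of `B`. -/
theorem exists_isLocatingColoring_of_embedding (hT : T.Connected) {m k : ℕ}
    {H : SimpleGraph (Fin m)} (f : T ↪g H) (B : Finset (Fin m)) (hB : ∀ b ∈ B, ∃ v, f v = b)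
    (c c' : Fin m → Fin k) (g g' : Fin m → Fin k → ℕ) (hzero : ∀ v i, g v i = 0 ↔ c v = i)
    (hzero' : ∀ v i, g' v i = 0 ↔ c' v = i)
    (hproper : ∀ u v, H.Adj u v → c u ≠ c v) (hproper' : ∀ v, c v ≠ c' v)
    (hlip : ∀ u v, H.Adj u v → ∀ i, g u i ≤ g v i + 1)
    (hlip' : ∀ v i, g v i ≤ g' v i + 1)
    (hdesc : ∀ v i, g v i ≠ 0 → g' v i + 1 = g v i ∨ ∃ w ∈ B, H.Adj v w ∧ g w i + 1 = g v i)
    (hdesc' : ∀ v i, g' v i ≠ 0 → g v i + 1 = g' v i)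
    (hinj : ∀ u v, g u = g v → u = v) (hinj' : ∀ u v, g' u = g' v → u = v)
    (hne : ∀ u v, g u ≠ g' v) :
    ∃ c : (pendantCorona T).Coloring (Fin k), IsLocatingColoring (pendantCorona T) c := by
  refine exists_isLocatingColoring_pendantCorona hT (c ∘ f) (c' ∘ f) (g ∘ f) (g' ∘ f)
    (fun v => hzero (f v)) (fun v => hzero' (f v))
    (fun u v h => hproper _ _ (f.map_adj_iff.2 h)) (fun v => hproper' _)
    (fun u v h => hlip _ _ (f.map_adj_iff.2 h)) (fun v => hlip' _) ?_ (fun v => hdesc' _) ?_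
  · intro v i h
    rcases hdesc (f v) i h with h1 | ⟨w, hw, hvw, h1⟩
    · exact Or.inl h1
    · obtain ⟨w, rfl⟩ := hB w hw
      exact Or.inr ⟨w, f.map_adj_iff.1 hvw, h1⟩
  · rintro (u | u) (v | v) h
    · exact congrArg Sum.inl (f.injective (hinj _ _ h))
    · exact (hne _ _ h).elim
    · exact (hne _ _ h.symm).elim
    · exact congrArg Sum.inr (f.injective (hinj' _ _ h))

instance decidableAdjPathGraph (n : ℕ) : DecidableRel (pathGraph n).Adj := fun _ _ =>
  decidable_of_iff _ pathGraph_adj.symm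

theorem exists_isLocatingColoring_of_embedding_pathGraph (hT : T.Connected) (f : T ↪g pathGraph 6)
    (hf : ∀ b, ∃ v, f v = b) :
    ∃ c : (pendantCorona T).Coloring (Fin 3), IsLocatingColoring (pendantCorona T) c :=
  exists_isLocatingColoring_of_embedding hT f Finset.univ (fun b _ => hf b)
    ![0, 1, 0, 1, 2, 0] ![2, 0, 1, 2, 1, 2]
    ![![0, 1, 1], ![1, 0, 2], ![0, 1, 2], ![1, 0, 1], ![1, 1, 0], ![0, 2, 1]]
    ![![1, 2, 0], ![0, 1, 3], ![1, 0, 3], ![2, 1, 0], ![2, 0, 1], ![1, 3, 0]]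
    (by decide) (by decide) (by decide) (by decide) (by decide) (by decide) (by decide)
    (by decide) (by decide) (by decide) (by decide)

theorem exists_isLocatingColoring_of_embedding_graphG3 (hT : T.Connected) (f : T ↪g graphG3)
    (hf : ∀ b ∈ ({1, 2, 3} : Finset (Fin 6)), ∃ v, f v = b) :
    ∃ c : (pendantCorona T).Coloring (Fin 3), IsLocatingColoring (pendantCorona T) c :=
  exists_isLocatingColoring_of_embedding hT f {1, 2, 3} hf
    ![0, 1, 0, 2, 0, 1] ![1, 2, 2, 1, 2, 0]
    ![![0, 1, 2], ![1, 0, 1], ![0, 1, 1], ![1, 1, 0], ![0, 2, 1], ![1, 0, 2]]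
    ![![1, 0, 3], ![2, 1, 0], ![1, 2, 0], ![2, 0, 1], ![1, 3, 0], ![0, 1, 3]]
    (by decide) (by decide) (by decide) (by decide) (by decide) (by decide) (by decide)
    (by decide) (by decide) (by decide) (by decide)

theorem exists_isLocatingColoring_of_iso_pathGraph (hT : T.Connected) {n : ℕ}
    (e : T ≃g pathGraph n) (h3 : 3 ≤ n) (h6 : n ≤ 6) :
    ∃ c : (pendantCorona T).Coloring (Fin 3), IsLocatingColoring (pendantCorona T) c := by
  have key : ∀ f : pathGraph n ↪g graphG3,
      (∀ b ∈ ({1, 2, 3} : Finset (Fin 6)), ∃ v, f v = b) →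
      ∃ c : (pendantCorona T).Coloring (Fin 3), IsLocatingColoring (pendantCorona T) c := by
    intro f hf
    refine exists_isLocatingColoring_of_embedding_graphG3 hT (f.comp e.toEmbedding) fun b hb => ?_
    obtain ⟨v, hv⟩ := hf b hb
    exact ⟨e.symm v, by simpa using hv⟩
  interval_cases n
  · exact key ⟨⟨![1, 2, 3], by decide⟩, by decide⟩ (by decide)
  · exact key ⟨⟨![0, 1, 2, 3], by decide⟩, by decide⟩ (by decide)
  · exact key ⟨⟨![0, 1, 2, 3, 4], by decide⟩, by decide⟩ (by decide)
  · exact exists_isLocatingColoring_of_embedding_pathGraph hT e.toEmbedding fun b =>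
      ⟨e.symm b, by simp⟩

theorem exists_isLocatingColoring_of_copy_graphG3 [Nontrivial V] (hT : T.Connected)
    (f : T.Copy graphG3) {v x y z : V} (hx : T.Adj v x) (hy : T.Adj v y) (hz : T.Adj v z)
    (hxy : x ≠ y) (hxz : x ≠ z) (hyz : y ≠ z) :
    ∃ c : (pendantCorona T).Coloring (Fin 3), IsLocatingColoring (pendantCorona T) c := by
  have hf : ∀ u w, T.Adj u w → graphG3.Adj (f u) (f w) := fun u w h => f.toHom.map_adj h
  have hinj : ∀ u w, f u = f w → u = w := fun u w h => f.injective h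
  have hnbr : ∀ v x y z, graphG3.Adj v x → graphG3.Adj v y → graphG3.Adj v z → x ≠ y → x ≠ z →
      y ≠ z → v = 2 ∧ (x = 1 ∨ y = 1 ∨ z = 1) ∧ (x = 3 ∨ y = 3 ∨ z = 3) ∧
        (x = 5 ∨ y = 5 ∨ z = 5) := by
    intro v x y z hx hy hz hxy hxz hyz
    have hdeg : ∀ v, v ≠ 2 → ∃ a b, ∀ x, graphG3.Adj v x → x = a ∨ x = b := by decide
    have hcen : ∀ x, graphG3.Adj 2 x → x = 1 ∨ x = 3 ∨ x = 5 := by decide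
    by_cases hv : v = 2
    · subst hv
      have h1 := hcen x hx
      have h2 := hcen y hy
      have h3 := hcen z hz
      grind
    · obtain ⟨a, b, hab⟩ := hdeg v hv
      have h1 := hab x hx
      have h2 := hab y hy
      have h3 := hab z hz
      grind
  obtain ⟨h2, h1, h3, h5⟩ := hnbr _ _ _ _ (hf _ _ hx) (hf _ _ hy) (hf _ _ hz)
    (fun h => hxy (hinj _ _ h)) (fun h => hxz (hinj _ _ h)) (fun h => hyz (hinj _ _ h))
  have hex : ∀ i, (f x = i ∨ f y = i ∨ f z = i) → ∃ w, f w = i ∧ T.Adj v w := by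
    rintro i (h | h | h)
    exacts [⟨x, h, hx⟩, ⟨y, h, hy⟩, ⟨z, h, hz⟩]
  have hcenter : ∀ u w, f u = 2 → graphG3.Adj (f u) (f w) → T.Adj u w := by
    intro u w hu h
    obtain rfl : u = v := hinj _ _ (hu.trans h2.symm)
    have : ∀ j, graphG3.Adj 2 j → j = 1 ∨ j = 3 ∨ j = 5 := by decide
    rw [hu] at h
    have hw : ∃ w', f w' = f w ∧ T.Adj u w' := by
      rcases this _ h with h | h | h <;> rw [h]
      exacts [hex 1 h1, hex 3 h3, hex 5 h5]
    obtain ⟨w', hw', hadj⟩ := hw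
    exact hinj _ _ hw' ▸ hadj
  have hend : ∀ u w, f u = 0 ∨ f u = 4 → graphG3.Adj (f u) (f w) → T.Adj u w := by
    intro u w hu h
    obtain ⟨w', hw'⟩ := hT.preconnected.exists_adj_of_nontrivial u
    have : ∀ i j k : Fin 6, i = 0 ∨ i = 4 → graphG3.Adj i j → graphG3.Adj i k → j = k := by decide
    exact hinj _ _ (this _ _ _ hu (hf _ _ hw') h) ▸ hw'
  have hback : ∀ u w, graphG3.Adj (f u) (f w) → T.Adj u w := by
    intro u w h
    have : ∀ i j, graphG3.Adj i j → i = 2 ∨ j = 2 ∨ (i = 0 ∨ i = 4) ∨ (j = 0 ∨ j = 4) := by decide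
    rcases this _ _ h with h' | h' | h' | h'
    · exact hcenter u w h' h
    · exact (hcenter w u h' h.symm).symm
    · exact hend u w h' h
    · exact (hend w u h' h.symm).symm
  refine exists_isLocatingColoring_of_embedding_graphG3 hT
    ⟨⟨f, f.injective⟩, fun {u w} => ⟨hback u w, hf u w⟩⟩ fun b hb => ?_
  simp only [Finset.mem_insert, Finset.mem_singleton] at hb
  rcases hb with rfl | rfl | rfl
  · obtain ⟨w, hw, -⟩ := hex 1 h1
    exact ⟨w, hw⟩
  · exact ⟨v, h2⟩
  · obtain ⟨w, hw, -⟩ := hex 3 h3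
    exact ⟨w, hw⟩

theorem exists_isLocatingColoring_of_isContained [Fintype V] (hT : T.IsTree)
    (h3 : 3 ≤ Fintype.card V)
    (h : T.IsContained (pathGraph 6) ∨ T.IsContained graphG3) :
    ∃ c : (pendantCorona T).Coloring (Fin 3), IsLocatingColoring (pendantCorona T) c := by
  have : Nontrivial V := Fintype.one_lt_card_iff_nontrivial.1 (by omega)
  have h6 : Fintype.card V ≤ 6 := by
    rcases h with ⟨⟨f⟩⟩ | ⟨⟨f⟩⟩
    · simpa using Fintype.card_le_of_injective _ f.injective
    · simpa using Fintype.card_le_of_injective _ f.injective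
  by_cases hdeg : ∀ v x y z, T.Adj v x → T.Adj v y → T.Adj v z → x = y ∨ x = z ∨ y = z
  · obtain ⟨e⟩ := nonempty_iso_pathGraph_of_isTree hT hdeg
    exact exists_isLocatingColoring_of_iso_pathGraph hT.connected e h3 h6
  · push Not at hdeg
    obtain ⟨v, x, y, z, hx, hy, hz, hxy, hxz, hyz⟩ := hdeg
    rcases h with ⟨⟨f⟩⟩ | ⟨⟨f⟩⟩
    · have hnbr : ∀ v x y z, (pathGraph 6).Adj v x → (pathGraph 6).Adj v y → (pathGraph 6).Adj v z →
          x = y ∨ x = z ∨ y = z := by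
        simp only [pathGraph_adj, Fin.ext_iff]
        omega
      rcases hnbr _ _ _ _ (f.toHom.map_adj hx) (f.toHom.map_adj hy) (f.toHom.map_adj hz) with
        h | h | h
      exacts [(hxy (f.injective h)).elim, (hxz (f.injective h)).elim, (hyz (f.injective h)).elim]
    · exact exists_isLocatingColoring_of_copy_graphG3 hT.connected f hx hy hz hxy hxz hyz

theorem exists_isLocatingColoring_of_card_eq_two [Fintype V] (hT : T.Connected)
    (h2 : Fintype.card V = 2) : ∃ c : T.Coloring (Fin 2), IsLocatingColoring T c := by
  let e := Fintype.equivFinOfCardEq h2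
  let c : T.Coloring (Fin 2) := Coloring.mk e fun h => e.injective.ne h.ne
  refine ⟨c, e.surjective, fun u v h => e.injective ?_⟩
  have hne : (c.colorClass (c u)).Nonempty := ⟨u, rfl⟩
  have h1 : colorCode T c v (c u) = 0 :=
    (congrFun h (c u)).symm.trans ((distToSet_eq_zero_iff hT hne).2 rfl)
  exact ((distToSet_eq_zero_iff hT hne).1 h1).symm

end UpperBound

end LocatingChromatic

open LocatingChromatic

theorem mainTheorem3 {V : Type*} [Fintype V] (T : SimpleGraph V) (hT : T.IsTree)
    (hn : 2 ≤ Fintype.card V) (hχ : LocatingChromatic.locatingChromaticNumber T = 3) :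
    ((T.IsContained (SimpleGraph.pathGraph 6) ∨ T.IsContained LocatingChromatic.graphG3) →
      LocatingChromatic.locatingChromaticNumber
        (LocatingChromatic.corona T (SimpleGraph.completeGraph (Fin 1))ᶜ) = 3) ∧
    (¬ (T.IsContained (SimpleGraph.pathGraph 6) ∨ T.IsContained LocatingChromatic.graphG3) →
      LocatingChromatic.locatingChromaticNumber
        (LocatingChromatic.corona T (SimpleGraph.completeGraph (Fin 1))ᶜ) = 4) := by
  have hconn := hT.connected
  have : Nontrivial V := Fintype.one_lt_card_iff_nontrivial.1 (by omega)
  have hmem : 3 ∈ {k : ℕ | ∃ c : T.Coloring (Fin k), IsLocatingColoring T c} := by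
    rw [← hχ]
    refine Nat.sInf_mem (Set.nonempty_iff_ne_empty.2 fun h => ?_)
    rw [locatingChromaticNumber, h, Nat.sInf_empty] at hχ
    omega
  have h3 : 3 ≤ Fintype.card V := by
    by_contra h
    have h2 : locatingChromaticNumber T ≤ 2 :=
      Nat.sInf_le (exists_isLocatingColoring_of_card_eq_two hconn (by omega))
    omega
  have hlow : ∀ k, (∃ c : (pendantCorona T).Coloring (Fin k),
      IsLocatingColoring (pendantCorona T) c) → 3 ≤ k := by
    rintro k ⟨c, hc⟩
    refine three_le_of_isLocatingColoring (pendantCorona_connected hconn) ?_ hc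
    simp
    omega
  constructor
  · intro h
    have hc := exists_isLocatingColoring_of_isContained hT h3 h
    exact le_antisymm (Nat.sInf_le hc) (le_csInf ⟨3, hc⟩ hlow)
  · intro h
    obtain ⟨c, hc⟩ := hmem
    have h4 := exists_isLocatingColoring_pendantCorona_succ hconn hc
    refine le_antisymm (Nat.sInf_le h4) (le_csInf ⟨4, h4⟩ fun k hk => ?_)
    rcases (hlow k hk).eq_or_lt with rfl | hk4
    · obtain ⟨c, hc⟩ := hk
      obtain ⟨D⟩ := nonempty_pendantLocatingData hconn hc
      exact (h (D.isContained hT)).elim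
    · exact hk4
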